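/- A Stirling permutation of order $n\ge 0$ is a rearrangement $\sigma=\sigma_1\cdots\sigma_{2n}$ of the multiset $\{1,1,2,2,\dots,n,n\}$ in which every element between the two occurrences of $i$ is greater than $i$, for each $i\in\{1,\dots,n\}$ (for $n=0$ there is one, the empty word). It avoids $123$ if there are no indices $i<j<k$ with $\sigma_i<\sigma_j<\sigma_k$; let $\mathcal Q_n(123)$ be the set of Stirling permutations of order $n$ that avoid $123$. Let $\mathrm{plat}(\sigma)$, $\mathrm{des}(\sigma)$, $\mathrm{asc}(\sigma)$ be the numbers of indices $i$, $1\le i\le 2n-1$, with $\sigma_i=\sigma_{i+1}$, $\sigma_i>\sigma_{i+1}$, $\sigma_i<\sigma_{i+1}$ respectively, and define the formal power series in $x$, with coefficients in $\mathbb Z[p,q,r]$, $$C_{123}(x,p,q,r)=\sum_{n\ge 0}\ \sum_{\sigma\in\mathcal Q_n(123)} x^n p^{\mathrm{plat}(\sigma)}q^{\mathrm{des}(\sigma)}r^{\mathrm{asc}(\sigma)} .$$ Then $f=q\,C_{123}(x,p,q,r)-q+1$ satisfies the cubic equation $$f=1+pqx\Bigl(-1+\bigl(2+x(pr+qr-pq)\bigr)f-pqx\bigl(1-x(p-r)(q-r)\bigr)f^2\Bigr)f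 .$$ The same identity therefore holds when $p,q,r$ are replaced by any elements of a commutative ring. -/

import Mathlib

namespace StirlingPerm

/-- The word `1,1,2,2,…,n,n`. -/
def letters (n : ℕ) : List ℕ := (List.range' 1 n).flatMap fun i => [i, i]

/-- Every element lying between two occurrences of a letter is greater than that letter. -/
def IsStirling (σ : List ℕ) : Prop :=
  ∀ i j k : Fin σ.length, i < j → j < k → σ.get i = σ.get k → σ.get i < σ.get j

/-- The word `σ` contains the pattern `τ`: at some positions `i₁ < ⋯ < iₖ` of `σ`
(the values of `e`), `σ_{i_s} < σ_{i_t}` whenever `τ_s < τ_t`. -/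
def Contains (σ τ : List ℕ) : Prop :=
  ∃ e : Fin τ.length ↪o Fin σ.length,
    ∀ s t : Fin τ.length, τ.get s < τ.get t → σ.get (e s) < σ.get (e t)

open Classical in
/-- `𝒬_n`: the Stirling permutations of order `n`, that is, the rearrangements of
`1,1,2,2,…,n,n` that satisfy the Stirling condition. -/
noncomputable def stirlingPerms (n : ℕ) : Finset (List ℕ) :=
  (letters n).permutations.toFinset.filter IsStirling

open Classical in
/-- `𝒬_n(τ)`: the Stirling permutations of order `n` that avoid the pattern `τ`. -/
noncomputable def avoiders (n : ℕ) (τ : List ℕ) : Finset (List ℕ) :=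
  (stirlingPerms n).filter fun σ => ¬ Contains σ τ

/-- Number of descents: adjacent pairs with `σ_i > σ_{i+1}`. -/
def des (σ : List ℕ) : ℕ := (σ.zip σ.tail).countP fun a => a.1 > a.2

/-- Number of ascents: adjacent pairs with `σ_i < σ_{i+1}`. -/
def asc (σ : List ℕ) : ℕ := (σ.zip σ.tail).countP fun a => a.1 < a.2

/-- Number of plateaus: adjacent pairs with `σ_i = σ_{i+1}`. -/
def plat (σ : List ℕ) : ℕ := (σ.zip σ.tail).countP fun a => a.1 = a.2

/-- `C_{n,τ}(p,q,r) = ∑_{σ ∈ 𝒬_n(τ)} p^{plat σ} q^{des σ} r^{asc σ}`. -/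
noncomputable def C {R : Type*} [CommRing R] (n : ℕ) (τ : List ℕ) (p q r : R) : R :=
  ∑ σ ∈ avoiders n τ, p ^ plat σ * q ^ des σ * r ^ asc σ

/-- `C_τ(x,p,q,r) = ∑_{n ≥ 0} C_{n,τ}(p,q,r) x^n`, a formal power series in `x`. -/
noncomputable def genFun {R : Type*} [CommRing R] (τ : List ℕ) (p q r : R) : PowerSeries R :=
  PowerSeries.mk fun n => C n τ p q r

end StirlingPerm

/-! Combinatorial half: build the words by inserting two copies of a new minimum `a`. The result `A
a B a D` is Stirling and avoids 123 exactly when the old word `A B D` is and does, `B D` is weakly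
decreasing, and neither insertion point separates equal letters (`triplewise_insert`). So both
copies go into free slots. Append a final 0: the weight of every nonempty word gains a factor `q`,
which is why `qC - q + 1` is the natural series. A copy of `a` then gains `q` at the right end or on
an ascent, `r` in any other free slot, and `p` if it follows its twin. Only the leftmost free slot
can lie on an ascent, so the number of free slots and one Boolean govern all later insertions: this
is the tree behind `treeWeight` (`sum_words_mul_treeWeight`, `mul_genFun_eq`).

Algebraic half: let `t` be the series at the root `(false, 1)` and `a_n` the one at `(true, n + 2)`.
The tree equations involve the earlier `a_l` only through `τ_n = qt + r∑_{l<n} a_l` and `υ_n = 1 -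
xpqt + xr∑_{l<n} τ_l`. The ansatz `a_n = ατ_n + vυ_n` closes up when `v` solves a cubic, and a
similar ansatz handles the labels `(false, n + 1)`. Consistency at the root gives `t = v/(1 +
pqxv)`. The equations determine all coefficients by induction on the degree, so the ansatz gives the
true series; eliminating `v` yields the cubic for `t` (`kernel_cubic`, `treeWeight_cubic`). -/

namespace StirlingPerm

/-! ### The weighted generating tree. -/

section GeneratingTree

variable {R : Type*} [CommRing R]

/-- The factor gained by inserting a small letter into the free slot of rank `i` of a word with `k`
free slots; `t` records whether the leftmost free slot lies on an ascent. -/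
def slotWeight {T : Type*} (q r : T) (t : Bool) (k i : ℕ) : T :=
  if i = 0 ∨ (t = true ∧ i + 1 = k) then q else r

/-- The factor gained by inserting two copies of a small letter into the free slots of ranks
`i ≤ j`. -/
def pairWeight (p q r : R) (t : Bool) (k i j : ℕ) : R :=
  if i = j then p * slotWeight q r t k i else slotWeight q r t k i * slotWeight q r t k j

/-- Whether the leftmost free slot lies on an ascent after an insertion at ranks `i ≤ j`. -/
def childFlag (t : Bool) (i j : ℕ) : Bool := if j = 0 then t else decide (i ≠ 0)

/-- The number of free slots after an insertion at ranks `i ≤ j`. -/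
def childSlots (k i j : ℕ) : ℕ := if j = 0 then k + 1 else i + 1

/-- The total weight of the nodes at depth `n` below a node labelled `(t, k)` of the generating
tree. -/
def treeWeight (p q r : R) : ℕ → Bool → ℕ → R
  | 0, _, _ => 1
  | n + 1, t, k => ∑ j ∈ Finset.range k, ∑ i ∈ Finset.range (j + 1),
      pairWeight p q r t k i j * treeWeight p q r n (childFlag t i j) (childSlots k i j)

/-- A family of power series satisfying the equations of the generating tree at all labels
`(false, k + 1)` and `(true, k + 2)` consists of the generating functions of the tree. -/
theorem coeff_eq_treeWeight (p q r : R) (G : Bool → ℕ → PowerSeries R)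
    (hG : ∀ t k, (bif t then 2 else 1) ≤ k → G t k = 1 + PowerSeries.X *
      ∑ j ∈ Finset.range k, ∑ i ∈ Finset.range (j + 1),
        PowerSeries.C (pairWeight p q r t k i j) * G (childFlag t i j) (childSlots k i j))
    (n : ℕ) : ∀ t k, (bif t then 2 else 1) ≤ k →
      PowerSeries.coeff n (G t k) = treeWeight p q r n t k := by
  induction n with
  | zero =>
    intro t k hk
    rw [hG t k hk]
    simp [treeWeight]
  | succ n ih =>
    intro t k hk
    rw [hG t k hk, map_add, PowerSeries.coeff_succ_X_mul]
    simp only [PowerSeries.coeff_one, Nat.succ_ne_zero, if_false, zero_add, map_sum,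
      PowerSeries.coeff_C_mul, treeWeight]
    refine Finset.sum_congr rfl fun j hj => Finset.sum_congr rfl fun i hi => ?_
    rw [ih]
    -- Children stay among the admissible labels: a child with flag `true` born at `j ≠ 0` has `i ≠
    -- 0`, hence at least two slots.
    cases t <;> simp [childFlag, childSlots] at * <;> grind

end GeneratingTree

/-! ### Solving the tree equations by a linear ansatz. -/

section Kernel

variable {A : Type*} [CommRing A]

/-- The state `(τ, υ)` of the linear recursion that solves the generating tree. -/
def kernelState (p q r x v t : A) : ℕ → A × A
  | 0 => (q * t, 1 - x * p * q * t)
  | n + 1 =>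
    let s := kernelState p q r x v t n
    (s.1 + r * ((x * (p + q) + p * q * x ^ 2 * r * v) * v * s.1 + v * s.2), s.2 + x * r * s.1)

/-- The generating function at the label `(true, n + 2)`. -/
def ascSeries (p q r x v t : A) (n : ℕ) : A :=
  (x * (p + q) + p * q * x ^ 2 * r * v) * v * (kernelState p q r x v t n).1 +
    v * (kernelState p q r x v t n).2

/-- The generating function at the label `(false, n + 1)`. -/
def descSeries (p q r x v t y : A) (n : ℕ) : A :=
  y * (kernelState p q r x v t n).1 + v * (1 - q * y) * (kernelState p q r x v t n).2

theorem kernelState_succ_fst (p q r x v t : A) (n : ℕ) :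
    (kernelState p q r x v t (n + 1)).1 =
      (kernelState p q r x v t n).1 + r * ascSeries p q r x v t n := rfl

theorem kernelState_succ_snd (p q r x v t : A) (n : ℕ) :
    (kernelState p q r x v t (n + 1)).2 =
      (kernelState p q r x v t n).2 + x * r * (kernelState p q r x v t n).1 := rfl

theorem kernelState_fst (p q r x v t : A) (n : ℕ) :
    (kernelState p q r x v t n).1 =
      q * t + r * ∑ l ∈ Finset.range n, ascSeries p q r x v t l := by
  induction n with
  | zero => simp [kernelState]
  | succ n ih => rw [kernelState_succ_fst, ih, Finset.sum_range_succ]; ring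

theorem kernelState_snd (p q r x v t : A) (n : ℕ) :
    (kernelState p q r x v t n).2 =
      1 - x * p * q * t + x * r * ∑ l ∈ Finset.range n, (kernelState p q r x v t l).1 := by
  induction n with
  | zero => simp [kernelState]
  | succ n ih => rw [kernelState_succ_snd, ih, Finset.sum_range_succ]; ring

/-- This is the tree equation at `(true, n + 2)` after summation. Comparing coefficients of `υ` in
the ansatz gives `hv`; comparing those of `τ` gives `α = v(x(p + q) + pqx²rv)`, the factor used in
`ascSeries`. -/
theorem ascSeries_rec {p q r x v : A} (t : A)
    (hv : v * (1 - 2 * (p * q) * x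
      - p * q * x * (x * v * (r * (p + q) + p * q * x * r ^ 2 * v))) = 1) (n : ℕ) :
    ascSeries p q r x v t n = p * q * x * (ascSeries p q r x v t n + ascSeries p q r x v t (n + 1))
      + x * (p + q) * (kernelState p q r x v t n).1 + (kernelState p q r x v t n).2 := by
  rw [ascSeries, ascSeries, kernelState_succ_snd, kernelState_succ_fst, ascSeries]
  generalize (kernelState p q r x v t n).1 = a
  generalize (kernelState p q r x v t n).2 = b
  linear_combination (x * (p + q) * a + b + p * q * x ^ 2 * r * v * a) * hv

theorem descSeries_rec {p q r x v y h : A} (t : A)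
    (hv : v * (1 - 2 * (p * q) * x
      - p * q * x * (x * v * (r * (p + q) + p * q * x * r ^ 2 * v))) = 1)
    (hh : (1 - p * q * x + p * r * x) * h = 1)
    (hy : y = x * p * (1 + x * v * (r * (p + q) + p * q * x * r ^ 2 * v)) * h) (n : ℕ) :
    descSeries p q r x v t y n = p * q * x * descSeries p q r x v t y (n + 1)
      + x * p * (kernelState p q r x v t n).1 + (kernelState p q r x v t n).2 := by
  have hy' : (1 - p * q * x + p * r * x) * y =
      x * p * (1 + x * v * (r * (p + q) + p * q * x * r ^ 2 * v)) := by
    rw [hy]; linear_combination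
      (x * p * (1 + x * v * (r * (p + q) + p * q * x * r ^ 2 * v))) * hh
  -- `h₂` and `h₁` compare the coefficients of `υ` and `τ` in the claimed recursion. Here `e = rα`,
  -- and `key` is `h₁` with `y` substituted and `xp` cancelled.
  have h₂ : v * (1 - q * y) * (1 - p * q * x) = 1 + p * q * x * r * v * y := by
    linear_combination hv - q * v * hy'
  set e := x * v * (r * (p + q) + p * q * x * r ^ 2 * v) with he
  have h₁ : y * (1 - p * q * x - p * q * x * e + p * q * x ^ 2 * r * q * v) =
      x * p + p * q * x ^ 2 * r * v := by
    have key : (1 + e) * (1 - p * q * x - p * q * x * e + p * q * x ^ 2 * r * q * v) =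
        (1 + q * x * r * v) * (1 - p * q * x + p * r * x) := by
      linear_combination (x * (r * (p + q) + p * q * x * r ^ 2 * v) - x * q * r) * hv +
        (1 - 2 * (p * q) * x - p * q * x * e) * he
    rw [hy]
    linear_combination x * p * h * key + (x * p + p * q * x ^ 2 * r * v) * hh
  rw [descSeries, descSeries, kernelState_succ_snd, kernelState_succ_fst, ascSeries]
  generalize (kernelState p q r x v t n).1 = a
  generalize (kernelState p q r x v t n).2 = b
  linear_combination a * h₁ + b * h₂ - p * q * x * y * a * he

/-- Self-consistency at the root: the state was started from a presumed root series `t`, and `t =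
v(1 - pqxt)`, that is `t = vg`, makes the ansatz return it for every `y`. -/
theorem descSeries_zero {p q r x v y g : A} (hg : (1 + p * q * x * v) * g = 1) :
    descSeries p q r x v (v * g) y 0 = v * g := by
  rw [descSeries]
  simp only [kernelState]
  linear_combination (-v * (1 - q * y)) * hg

/-- With `w = 1/v` one has `1/t = w + pqx`, and `w` satisfies a monic cubic; shift it by `pqx` and
multiply by `t³`. -/
theorem kernel_cubic {p q r x v g t : A}
    (hv : v * (1 - 2 * (p * q) * x
      - p * q * x * (x * v * (r * (p + q) + p * q * x * r ^ 2 * v))) = 1)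
    (hg : (1 + p * q * x * v) * g = 1) (ht : t = v * g) :
    t = 1 + p * q * x * (-1 + (2 + x * (p * r + q * r - p * q)) * t
      - p * q * x * (1 - x * (p - r) * (q - r)) * t ^ 2) * t := by
  obtain ⟨w, hw⟩ : ∃ w, w = 1 - 2 * (p * q) * x
      - p * q * x * (x * v * (r * (p + q) + p * q * x * r ^ 2 * v)) := ⟨_, rfl⟩
  rw [← hw] at hv
  have hw3 : w ^ 3 = (1 - 2 * (p * q) * x) * w ^ 2 - p * q * x ^ 2 * (r * (p + q)) * w
      - (p * q) ^ 2 * x ^ 3 * r ^ 2 := by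
    linear_combination w ^ 2 * hw - p * q * x ^ 2 * (r * (p + q) * w
      + p * q * x * r ^ 2 * (v * w + 1)) * hv
  have hty : t * (w + p * q * x) = 1 := by
    rw [ht]; linear_combination g * hv + hg
  obtain ⟨y, hy⟩ : ∃ y, y = w + p * q * x := ⟨_, rfl⟩
  have hwy : w = y - p * q * x := by rw [hy]; ring
  rw [← hy] at hty
  rw [hwy] at hw3
  linear_combination (-t ^ 3) * hw3 + ((t ^ 2 * y ^ 2 + t * y + 1) -
    (1 + p * q * x) * t * (t * y + 1) + (2 * (p * q) * x + p * q * x ^ 2 * (p * r + q * r - p * q))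
      * t ^ 2) * hty

end Kernel

/-! ### Power series solution and the cubic for the tree. -/

section TreeSeries

variable {R : Type*} [CommRing R]

/-- Every equation `v = 1 + X * Φ v` with `Φ` a cubic polynomial has a power series solution. -/
theorem exists_eq_one_add_X_mul (a b c : PowerSeries R) :
    ∃ v : PowerSeries R, v = 1 + PowerSeries.X * (a * v + b * v ^ 2 + c * v ^ 3) := by
  let Φ : PowerSeries R → PowerSeries R :=
    fun v => 1 + PowerSeries.X * (a * v + b * v ^ 2 + c * v ^ 3)
  -- `Φ` is an `X`-adic contraction, so its iterates from 0 converge to a fixed point.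
  have hΦ : ∀ n u v, (PowerSeries.X : PowerSeries R) ^ n ∣ u - v →
      (PowerSeries.X : PowerSeries R) ^ (n + 1) ∣ Φ u - Φ v := by
    rintro n u v ⟨d, hd⟩
    refine ⟨d * (a + b * (u + v) + c * (u ^ 2 + u * v + v ^ 2)), ?_⟩
    simp only [Φ]
    linear_combination PowerSeries.X * (a + b * (u + v) + c * (u ^ 2 + u * v + v ^ 2)) * hd
  let s : ℕ → PowerSeries R := fun n => Φ^[n] 0
  have hs : ∀ n, s (n + 1) = Φ (s n) := fun n => Function.iterate_succ_apply' Φ n 0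
  have hstep : ∀ n, (PowerSeries.X : PowerSeries R) ^ n ∣ s (n + 1) - s n := by
    intro n
    induction n with
    | zero => simp
    | succ n ih => rw [hs (n + 1), hs n]; exact hΦ n _ _ (by rw [← hs n]; exact ih)
  have hle : ∀ n k, (PowerSeries.X : PowerSeries R) ^ n ∣ s (n + k) - s n := by
    intro n k
    induction k with
    | zero => simp
    | succ k ih =>
      have h := dvd_add ((pow_dvd_pow _ (Nat.le_add_right n k)).trans (hstep (n + k))) ih
      rwa [sub_add_sub_cancel] at h
  -- The `n`-th coefficient of the iterates is constant from `s (n + 1)` on.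
  let v : PowerSeries R := PowerSeries.mk fun n => PowerSeries.coeff n (s (n + 1))
  have hv : ∀ n, (PowerSeries.X : PowerSeries R) ^ n ∣ v - s n := by
    intro n
    rw [PowerSeries.X_pow_dvd_iff]
    intro m hm
    obtain ⟨k, rfl⟩ := Nat.exists_eq_add_of_lt hm
    have h := PowerSeries.X_pow_dvd_iff.1 (hle (m + 1) k) m (Nat.lt_succ_self m)
    rw [map_sub, show m + 1 + k = m + k + 1 by ring] at h
    rw [map_sub, PowerSeries.coeff_mk]
    linear_combination -h
  refine ⟨v, ?_⟩
  have h0 : ∀ n, (PowerSeries.X : PowerSeries R) ^ n ∣ v - Φ v := by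
    intro n
    have h1 := (pow_dvd_pow _ (Nat.le_succ n)).trans (hΦ n _ _ (hv n))
    have h2 := (pow_dvd_pow _ (Nat.le_succ n)).trans (hv (n + 1))
    rw [hs] at h2
    have h3 := dvd_sub h2 h1
    rwa [sub_sub_sub_cancel_right] at h3
  ext n
  have h := PowerSeries.X_pow_dvd_iff.1 (h0 (n + 1)) n (Nat.lt_succ_self n)
  rw [map_sub, sub_eq_zero] at h
  exact h

theorem exists_mul_eq_one_of_X_mul (a : PowerSeries R) :
    ∃ b : PowerSeries R, (1 + PowerSeries.X * a) * b = 1 := by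
  have h : IsUnit (1 + PowerSeries.X * a) := by
    rw [PowerSeries.isUnit_iff_constantCoeff]; simp
  exact h.exists_right_inv

/-- The generating tree sum at a node, split by the larger rank `j`. -/
theorem sum_pairWeight_eq {A : Type*} [CommRing A] [Algebra R A] (p q r : R) (t : Bool) (k : ℕ)
    (up : A) (desc₀ : A) (a : ℕ → A) (G : Bool → ℕ → A)
    (hup : G t (k + 2) = up) (hdesc : G false 1 = desc₀) (hasc : ∀ n, G true (n + 2) = a n) :
    ∑ j ∈ Finset.range (k + 1), ∑ i ∈ Finset.range (j + 1),
        algebraMap R A (pairWeight p q r t (k + 1) i j) *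
          G (childFlag t i j) (childSlots (k + 1) i j) =
      algebraMap R A (p * q) * up + ∑ j ∈ Finset.range k,
        algebraMap R A (slotWeight q r t (k + 1) (j + 1)) *
          (algebraMap R A p * a j + algebraMap R A q * desc₀ +
            algebraMap R A r * ∑ i ∈ Finset.range j, a i) := by
  rw [Finset.sum_range_succ', add_comm]
  congr 1
  · simp [pairWeight, slotWeight, childFlag, childSlots, hup]
  · refine Finset.sum_congr rfl fun j hj => ?_
    rw [Finset.mem_range] at hj
    rw [Finset.sum_range_succ, Finset.sum_range_succ']
    have h : ∀ i ∈ Finset.range j,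
        algebraMap R A (pairWeight p q r t (k + 1) (i + 1) (j + 1)) *
          G (childFlag t (i + 1) (j + 1)) (childSlots (k + 1) (i + 1) (j + 1)) =
        algebraMap R A (slotWeight q r t (k + 1) (j + 1)) * (algebraMap R A r * a i) := by
      intro i hi
      rw [Finset.mem_range] at hi
      have h1 : slotWeight q r t (k + 1) (i + 1) = r := by
        rw [slotWeight, if_neg]; rintro (h | ⟨-, h⟩) <;> omega
      rw [pairWeight, if_neg (by omega), h1, map_mul]
      simp only [childFlag, childSlots, Nat.succ_ne_zero, if_false, ne_eq, not_false_eq_true,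
        decide_true, hasc]
      ring
    rw [Finset.sum_congr rfl h, ← Finset.mul_sum, ← Finset.mul_sum]
    simp only [pairWeight, childFlag, childSlots, Nat.succ_ne_zero, if_false, ne_eq,
      not_false_eq_true, decide_true, hasc, if_true, map_mul, not_true_eq_false, decide_false,
      (Nat.succ_ne_zero j).symm, hdesc, zero_add]
    rw [show slotWeight q r t (k + 1) 0 = q by simp [slotWeight]]
    ring

/-- The generating function of the tree rooted at `(false, 1)` solves the cubic equation. -/
theorem treeWeight_cubic (p q r : R) (x P Q S t : PowerSeries R)
    (hx : x = PowerSeries.X) (hP : P = PowerSeries.C p) (hQ : Q = PowerSeries.C q)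
    (hS : S = PowerSeries.C r)
    (ht : t = PowerSeries.mk fun n => treeWeight p q r n false 1) :
    t = 1 + P * Q * x * (-1 + (2 + x * (P * S + Q * S - P * Q)) * t
      - P * Q * x * (1 - x * (P - S) * (Q - S)) * t ^ 2) * t := by
  obtain ⟨v, hv⟩ := exists_eq_one_add_X_mul (2 * (P * Q)) (P * Q * x * (S * (P + Q)))
    ((P * Q) ^ 2 * x ^ 2 * S ^ 2)
  obtain ⟨g, hg⟩ := exists_mul_eq_one_of_X_mul (P * Q * v)
  obtain ⟨h, hh⟩ := exists_mul_eq_one_of_X_mul (- (P * Q) + P * S)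
  rw [← hx] at hv hg hh
  have hv' : v * (1 - 2 * (P * Q) * x
      - P * Q * x * (x * v * (S * (P + Q) + P * Q * x * S ^ 2 * v))) = 1 := by
    linear_combination hv
  have hg' : (1 + P * Q * x * v) * g = 1 := by linear_combination hg
  have hh' : (1 - P * Q * x + P * S * x) * h = 1 := by linear_combination hh
  obtain ⟨y, hy⟩ : ∃ y, y = x * P * (1 + x * v * (S * (P + Q) + P * Q * x * S ^ 2 * v)) * h :=
    ⟨_, rfl⟩
  -- The truncated subtractions are harmless: only labels with `k ≥ 2` for `true` and `k ≥ 1` for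
  -- `false` matter.
  let G : Bool → ℕ → PowerSeries R := fun b k =>
    bif b then ascSeries P Q S x v (v * g) (k - 2) else descSeries P Q S x v (v * g) y (k - 1)
  have hroot : G false 1 = v * g := descSeries_zero hg'
  suffices hG : t = v * g from kernel_cubic hv' hg' hG
  rw [ht, ← hroot]
  ext n
  rw [PowerSeries.coeff_mk]
  refine (coeff_eq_treeWeight p q r G ?_ n false 1 le_rfl).symm
  intro b k hk
  obtain ⟨k, rfl⟩ : ∃ k', k = k' + 1 := ⟨k - 1, by cases b <;> simp at hk <;> omega⟩
  have hsum := sum_pairWeight_eq (A := PowerSeries R) p q r b k (G b (k + 2)) (v * g)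
    (ascSeries P Q S x v (v * g)) G rfl hroot (fun n => rfl)
  simp only [show ∀ z : R, algebraMap R (PowerSeries R) z = PowerSeries.C z from fun z => rfl,
    map_mul, ← hP, ← hQ, ← hS] at hsum
  simp only [← hx]
  rw [hsum]
  have hτ : ∀ j, P * ascSeries P Q S x v (v * g) j + Q * (v * g) +
      S * ∑ i ∈ Finset.range j, ascSeries P Q S x v (v * g) i =
      P * ascSeries P Q S x v (v * g) j + (kernelState P Q S x v (v * g) j).1 := by
    intro j; rw [kernelState_fst]; ring
  simp only [hτ]
  have hτsum : ∀ m, S * ∑ j ∈ Finset.range m, (P * ascSeries P Q S x v (v * g) j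
      + (kernelState P Q S x v (v * g) j).1) =
      P * ((kernelState P Q S x v (v * g) m).1 - Q * (v * g)) +
        S * ∑ j ∈ Finset.range m, (kernelState P Q S x v (v * g) j).1 := by
    intro m
    rw [kernelState_fst, Finset.sum_add_distrib, ← Finset.mul_sum]; ring
  -- All slots of positive rank weigh `r`, except the leftmost one under flag `true`, whose term is
  -- split off below.
  have hlow : ∀ m ≤ k, (b = false ∨ m < k) → ∑ j ∈ Finset.range m,
      PowerSeries.C (slotWeight q r b (k + 1) (j + 1)) * (P * ascSeries P Q S x v (v * g) j
        + (kernelState P Q S x v (v * g) j).1) =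
      P * ((kernelState P Q S x v (v * g) m).1 - Q * (v * g)) +
        S * ∑ j ∈ Finset.range m, (kernelState P Q S x v (v * g) j).1 := by
    intro m hm hb
    rw [← hτsum, Finset.mul_sum]
    refine Finset.sum_congr rfl fun j hj => ?_
    rw [Finset.mem_range] at hj
    rw [slotWeight, if_neg, hS]
    rintro (h | ⟨h, h'⟩)
    · omega
    · rcases hb with hb | hb
      · simp [hb] at h
      · omega
  cases b with
  | false =>
    rw [hlow k le_rfl (Or.inl rfl)]
    have h1 := descSeries_rec (v * g) hv' hh' hy k
    have h2 := kernelState_snd P Q S x v (v * g) k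
    simp only [G, cond_false, Nat.add_sub_cancel, show k + 2 - 1 = k + 1 from rfl]
    linear_combination h1 + h2
  | true =>
    obtain ⟨k, rfl⟩ : ∃ k', k = k' + 1 := ⟨k - 1, by simp at hk; omega⟩
    rw [Finset.sum_range_succ, hlow k (Nat.le_succ k) (Or.inr (Nat.lt_succ_self k))]
    have h1 := ascSeries_rec (v * g) hv' k
    have h2 := kernelState_snd P Q S x v (v * g) k
    rw [show slotWeight q r true (k + 1 + 1) (k + 1) = q by simp [slotWeight], ← hQ]
    simp only [G, cond_true, show k + 1 + 1 - 2 = k from rfl, show k + 1 + 2 - 2 = k + 1 from rfl]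
    linear_combination h1 + h2

end TreeSeries

/-! ### Stirling words avoiding 123, and their free slots. -/

section Words

/-- The triples allowed in a Stirling word that avoids `123`. -/
def GoodTriple (x y z : ℕ) : Prop := (x = z → x < y) ∧ ¬ (x < y ∧ y < z)

theorem isStirling_and_not_contains_iff (σ : List ℕ) :
    IsStirling σ ∧ ¬ Contains σ [1, 2, 3] ↔ σ.Triplewise GoodTriple := by
  rw [List.triplewise_iff_getElem]
  constructor
  · rintro ⟨h₁, h₂⟩ i j k hij hjk hk
    refine ⟨fun h => h₁ ⟨i, by omega⟩ ⟨j, by omega⟩ ⟨k, hk⟩ hij hjk h, ?_⟩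
    rintro ⟨h₃, h₄⟩
    apply h₂
    have hmono : StrictMono (![⟨i, by omega⟩, ⟨j, by omega⟩, ⟨k, hk⟩] : Fin 3 → Fin σ.length) := by
      rw [Fin.strictMono_iff_lt_succ]
      intro s
      fin_cases s
      · exact hij
      · exact hjk
    refine ⟨OrderEmbedding.ofStrictMono _ hmono, fun s t hst => ?_⟩
    fin_cases s <;> fin_cases t <;> simp at hst ⊢ <;> omega
  · intro h
    refine ⟨fun i j k hij hjk hik => (h i j k hij hjk k.2).1 hik, ?_⟩
    rintro ⟨e, he⟩
    have h01 : e (0 : Fin 3) < e (1 : Fin 3) := e.strictMono (by decide)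
    have h12 : e (1 : Fin 3) < e (2 : Fin 3) := e.strictMono (by decide)
    exact (h _ _ _ h01 h12 (e (2 : Fin 3)).2).2
      ⟨he (0 : Fin 3) (1 : Fin 3) (by decide), he (1 : Fin 3) (2 : Fin 3) (by decide)⟩

open Classical in
/-- The `123`-avoiding Stirling words on the letters `a, a, …, a + m - 1, a + m - 1`. -/
noncomputable def words (a m : ℕ) : Finset (List ℕ) :=
  ((List.range' a m).flatMap fun i => [i, i]).permutations.toFinset.filter
    (List.Triplewise GoodTriple)

theorem mem_words {a m : ℕ} {σ : List ℕ} :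
    σ ∈ words a m ↔
      σ.Perm ((List.range' a m).flatMap fun i => [i, i]) ∧ σ.Triplewise GoodTriple := by
  simp [words]

theorem avoiders_eq_words (n : ℕ) : avoiders n [1, 2, 3] = words 1 n := by
  ext σ
  rw [mem_words, ← isStirling_and_not_contains_iff]
  simp [avoiders, stirlingPerms, letters, and_assoc]

theorem words_zero (a : ℕ) : words a 0 = {[]} := by
  ext σ
  rw [mem_words]
  simp only [List.range'_zero, List.flatMap_nil, List.perm_nil, Finset.mem_singleton]
  constructor
  · exact fun h => h.1
  · rintro rfl; simp

theorem le_of_mem_words {a m : ℕ} {σ : List ℕ} (hσ : σ ∈ words a m) {x : ℕ} (hx : x ∈ σ) :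
    a ≤ x := by
  have h := (mem_words.1 hσ).1.mem_iff.1 hx
  simp only [List.mem_flatMap, List.mem_range'_1] at h
  obtain ⟨i, hi, h⟩ := h
  simp at h; omega

/-- Triples `a y z` force a weakly decreasing tail after the first `a`. Triples `x a x` break the
Stirling condition, which forces disjointness across each copy. Other triples containing `a` impose
nothing new. -/
theorem triplewise_insert {a : ℕ} {A B D : List ℕ} (hA : ∀ x ∈ A, a < x) (hB : ∀ x ∈ B, a < x)
    (hD : ∀ x ∈ D, a < x) :
    (A ++ a :: (B ++ a :: D)).Triplewise GoodTriple ↔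
      (A ++ (B ++ D)).Triplewise GoodTriple ∧ (B ++ D).Pairwise (· ≥ ·) ∧
        A.Disjoint (B ++ D) ∧ (A ++ B).Disjoint D := by
  have h₁ : ∀ L : List ℕ, (∀ x ∈ L, a < x) →
      (L.Pairwise (GoodTriple a) ↔ L.Pairwise (· ≥ ·)) := fun L hL =>
    List.Pairwise.iff_of_mem fun {y z} hy hz => by
      have := hL y hy; have := hL z hz; simp only [GoodTriple]; omega
  have h₂ : ∀ L : List ℕ, (∀ x ∈ L, a < x) → (L.Pairwise (fun x y => GoodTriple x y a) ↔ True) :=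
    fun L hL => iff_true_intro (List.Pairwise.imp_of_mem (R := fun _ _ => True)
      (fun {y z} hy hz _ => by have := hL y hy; simp only [GoodTriple]; omega)
      (List.pairwise_of_forall fun _ _ => trivial))
  have h₃ : ∀ L M : List ℕ, (∀ x ∈ L, a < x) → (∀ x ∈ M, a < x) →
      ((∀ x ∈ L, ∀ z ∈ M, GoodTriple x a z) ↔ L.Disjoint M) := by
    intro L M hL hM
    refine forall₂_congr fun x hx => ?_
    simp only [GoodTriple]
    exact ⟨fun h hz => by have := h x hz; have := hL x hx; omega, fun h z hz =>
      ⟨fun e => absurd (e ▸ hz) h, by have := hL x hx; omega⟩⟩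
  have h₄ : ∀ L : List ℕ, (∀ x ∈ L, a < x) → ((∀ z ∈ L, GoodTriple a a z) ↔ True) := by
    intro L hL
    refine iff_true_intro fun z hz => ?_
    have := hL z hz; simp only [GoodTriple]; omega
  have h₅ : ∀ L : List ℕ, (∀ x ∈ L, a < x) → ((∀ z ∈ L, GoodTriple a z a) ↔ True) := by
    intro L hL
    refine iff_true_intro fun z hz => ?_
    have := hL z hz; simp only [GoodTriple]; omega
  have h₆ : (∀ y ∈ B, ∀ z ∈ D, GoodTriple a y z) ↔ ∀ y ∈ B, ∀ z ∈ D, y ≥ z := by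
    refine forall₄_congr fun y hy z hz => ?_
    have := hB y hy; have := hD z hz; simp only [GoodTriple]; omega
  have h₇ : ∀ L M : List ℕ, (∀ x ∈ L, a < x) →
      ((∀ x ∈ L, ∀ z ∈ M, GoodTriple x z a) ↔ True) := by
    intro L M hL
    refine iff_true_intro fun x hx z hz => ?_
    have := hL x hx; simp only [GoodTriple]; omega
  have h₈ : ∀ L : List ℕ, (∀ x ∈ L, a < x) → ((∀ x ∈ L, GoodTriple x a a) ↔ True) := by
    intro L hL
    refine iff_true_intro fun z hz => ?_
    have := hL z hz; simp only [GoodTriple]; omega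
  simp only [List.triplewise_append, List.triplewise_cons, List.pairwise_append, List.pairwise_cons,
    List.mem_append, List.mem_cons, or_imp, forall_and, forall_eq, List.disjoint_append_left,
    List.disjoint_append_right, h₁ B hB, h₁ D hD, h₂ A hA, h₂ B hB, h₃ _ _ hA hB,
    h₃ _ _ hA hD, h₃ _ _ hB hD, h₄ D hD, h₅ B hB, h₆, h₇ _ _ hA, h₈ _ hA]
  tauto

/-- The suffix of length `l` of `σ` is weakly decreasing and shares no letter with the rest of
`σ`; so a new smallest letter may be inserted in front of it. -/
def IsFreeSlot (σ : List ℕ) (l : ℕ) : Prop :=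
  ∃ A E, σ = A ++ E ∧ E.length = l ∧ A.Disjoint E ∧ E.Pairwise (· ≥ ·)

/-- The suffix of length `l` of `σ` is nonempty and preceded by a letter smaller than its first. -/
def IsAscSlot (σ : List ℕ) (l : ℕ) : Prop :=
  ∃ A u v E, σ = A ++ u :: v :: E ∧ E.length + 1 = l ∧ u < v

open Classical in
/-- The set of free slots of a word. -/
noncomputable def freeSlots (σ : List ℕ) : Finset ℕ :=
  (Finset.range (σ.length + 1)).filter (IsFreeSlot σ)

open Classical in
/-- Whether some free slot of the word lies on an ascent. -/
noncomputable def ascFlag (σ : List ℕ) : Bool := decide (∃ l ∈ freeSlots σ, IsAscSlot σ l)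

/-- The number of free slots to the right of a slot. -/
noncomputable def slotRank (σ : List ℕ) (l : ℕ) : ℕ := ((freeSlots σ).filter (· < l)).card

theorem mem_freeSlots {σ : List ℕ} {l : ℕ} : l ∈ freeSlots σ ↔ IsFreeSlot σ l := by
  simp only [freeSlots, Finset.mem_filter, Finset.mem_range, and_iff_right_iff_imp]
  rintro ⟨A, E, rfl, rfl, -⟩
  simp

theorem isFreeSlot_append {A E : List ℕ} :
    IsFreeSlot (A ++ E) E.length ↔ A.Disjoint E ∧ E.Pairwise (· ≥ ·) := by
  constructor
  · rintro ⟨A', E', h, hl, h'⟩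
    obtain ⟨rfl, rfl⟩ := List.append_inj' h hl.symm
    exact h'
  · exact fun h => ⟨A, E, rfl, rfl, h⟩

theorem isAscSlot_append {A E : List ℕ} {u v : ℕ} :
    IsAscSlot (A ++ u :: v :: E) (E.length + 1) ↔ u < v := by
  constructor
  · rintro ⟨A', u', v', E', h, hl, h'⟩
    obtain ⟨rfl, h⟩ := List.append_inj' h (by simp; omega)
    grind
  · exact fun h => ⟨A, u, v, E, rfl, rfl, h⟩

theorem zero_mem_freeSlots (σ : List ℕ) : 0 ∈ freeSlots σ :=
  mem_freeSlots.2 ⟨σ, [], by simp⟩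

/-- Two nested free slots cut the word in three pieces. -/
theorem exists_split {σ : List ℕ} {l₁ l₂ : ℕ} (h₁ : l₁ ∈ freeSlots σ) (h₂ : l₂ ∈ freeSlots σ)
    (hl : l₂ ≤ l₁) : ∃ A B D, σ = A ++ (B ++ D) ∧ l₁ = B.length + D.length ∧ l₂ = D.length ∧
      (B ++ D).Pairwise (· ≥ ·) ∧ A.Disjoint (B ++ D) ∧ (A ++ B).Disjoint D := by
  obtain ⟨A, E, rfl, rfl, h₃, h₄⟩ := mem_freeSlots.1 h₁
  obtain ⟨A', D, h, rfl, h₅, h₆⟩ := mem_freeSlots.1 h₂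
  rcases List.append_eq_append_iff.1 h with ⟨B, rfl, rfl⟩ | ⟨B, rfl, rfl⟩
  · exact ⟨A, B, D, rfl, by simp, rfl, h₄, h₃, h₅⟩
  · obtain rfl : B = [] := by
      rw [List.length_append] at hl
      exact List.length_eq_zero_iff.1 (by omega)
    exact ⟨A', [], E, by simp, by simp, by simp, h₄, by simpa using h₃, by simpa using h₃⟩

end Words

/-! ### Reindexing sums over a finite set by rank. -/

section Ranks

theorem sum_card_filter_lt {M : Type*} [AddCommMonoid M] (S : Finset ℕ) (g : ℕ → M) :
    ∑ l ∈ S, g (S.filter (· < l)).card = ∑ i ∈ Finset.range S.card, g i := by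
  induction S using Finset.induction_on_max with
  | empty => simp
  | insert b S hb ih =>
    have hbS : b ∉ S := fun h => lt_irrefl _ (hb b h)
    rw [Finset.sum_insert hbS, Finset.card_insert_of_notMem hbS, Finset.sum_range_succ, ← ih,
      add_comm]
    congr 1
    · refine Finset.sum_congr rfl fun l hl => ?_
      rw [Finset.filter_insert, if_neg (not_lt.2 (hb l hl).le)]
    · rw [Finset.filter_insert, if_neg (lt_irrefl b), Finset.filter_true_of_mem hb]

theorem card_filter_le_eq {S : Finset ℕ} {l : ℕ} (hl : l ∈ S) :
    (S.filter (· ≤ l)).card = (S.filter (· < l)).card + 1 := by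
  rw [← Finset.card_insert_of_notMem (a := l) (by simp)]
  congr 1
  ext x
  simp only [Finset.mem_filter, Finset.mem_insert]
  constructor
  · rintro ⟨h, h'⟩; rcases h'.lt_or_eq with h' | h' <;> simp [*]
  · rintro (rfl | ⟨h, h'⟩)
    · exact ⟨hl, le_rfl⟩
    · exact ⟨h, h'.le⟩

theorem sum_pairs_eq_sum_range {M : Type*} [AddCommMonoid M] (S : Finset ℕ) (g : ℕ → ℕ → M) :
    ∑ l₁ ∈ S, ∑ l₂ ∈ S.filter (· ≤ l₁), g (S.filter (· < l₂)).card (S.filter (· < l₁)).card =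
      ∑ j ∈ Finset.range S.card, ∑ i ∈ Finset.range (j + 1), g i j := by
  rw [← sum_card_filter_lt S fun j => ∑ i ∈ Finset.range (j + 1), g i j]
  refine Finset.sum_congr rfl fun l₁ h₁ => ?_
  rw [← card_filter_le_eq h₁, ← sum_card_filter_lt]
  refine Finset.sum_congr rfl fun l₂ h₂ => ?_
  congr 2
  ext x
  simp only [Finset.mem_filter] at h₂ ⊢
  constructor
  · exact fun h => ⟨⟨h.1, by omega⟩, h.2⟩
  · exact fun h => ⟨h.1.1, h.2⟩

end Ranks

/-! ### Inserting two copies of a new minimum. -/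

section Insertion

/-- Insert two copies of `a` into `σ`, in front of the suffixes of lengths `l₁ ≥ l₂`. -/
def insertPair (a : ℕ) (σ : List ℕ) (l₁ l₂ : ℕ) : List ℕ :=
  σ.take (σ.length - l₁) ++
    a :: ((σ.drop (σ.length - l₁)).take (l₁ - l₂) ++ a :: σ.drop (σ.length - l₂))

theorem insertPair_append (a : ℕ) (A B D : List ℕ) :
    insertPair a (A ++ (B ++ D)) (B.length + D.length) D.length =
      A ++ a :: (B ++ a :: D) := by
  have h₁ : (A ++ (B ++ D)).length - (B.length + D.length) = A.length := by simp
  have h₂ : (A ++ (B ++ D)).length - D.length = (A ++ B).length := by simp; omega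
  rw [insertPair, h₁, h₂, List.take_left, List.drop_left, Nat.add_sub_cancel, List.take_left,
    ← List.append_assoc A B D, List.drop_left]

theorem doubled_succ (a m : ℕ) : ((List.range' a (m + 1)).flatMap fun i => [i, i]) =
    a :: a :: ((List.range' (a + 1) m).flatMap fun i => [i, i]) := by
  simp [List.range'_succ]

theorem perm_insert (a : ℕ) (A B D : List ℕ) :
    (A ++ a :: (B ++ a :: D)).Perm (a :: a :: (A ++ (B ++ D))) := by
  refine List.perm_middle.trans (List.Perm.cons a ?_)
  rw [← List.append_assoc, ← List.append_assoc]
  exact List.perm_middle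

theorem insert_mem_words {a m : ℕ} {A B D : List ℕ} (hσ : A ++ (B ++ D) ∈ words (a + 1) m)
    (hs : (B ++ D).Pairwise (· ≥ ·)) (h₁ : A.Disjoint (B ++ D)) (h₂ : (A ++ B).Disjoint D) :
    A ++ a :: (B ++ a :: D) ∈ words a (m + 1) := by
  have hlt : ∀ x ∈ A ++ (B ++ D), a < x := fun x hx => le_of_mem_words hσ hx
  rw [mem_words] at hσ ⊢
  rw [triplewise_insert (fun x hx => hlt x (by simp [hx])) (fun x hx => hlt x (by simp [hx]))
    (fun x hx => hlt x (by simp [hx])), doubled_succ]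
  exact ⟨(perm_insert a A B D).trans ((hσ.1.cons a).cons a), hσ.2, hs, h₁, h₂⟩

theorem exists_eq_insert_of_mem_words {a m : ℕ} {w : List ℕ} (hw : w ∈ words a (m + 1)) :
    ∃ A B D, w = A ++ a :: (B ++ a :: D) ∧ A ++ (B ++ D) ∈ words (a + 1) m ∧
      (B ++ D).Pairwise (· ≥ ·) ∧ A.Disjoint (B ++ D) ∧ (A ++ B).Disjoint D := by
  obtain ⟨hp, ht⟩ := mem_words.1 hw
  rw [doubled_succ] at hp
  have ha : a ∉ (List.range' (a + 1) m).flatMap fun i => [i, i] := by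
    simp [List.mem_range'_1]
  have hc : w.count a = 2 := by
    rw [hp.count_eq, List.count_cons_self, List.count_cons_self, List.count_eq_zero_of_not_mem ha]
  obtain ⟨A, X, rfl, hA⟩ := List.eq_append_cons_of_mem
    (List.count_pos_iff.1 (by omega : 0 < w.count a))
  rw [List.count_append, List.count_cons_self, List.count_eq_zero_of_not_mem hA] at hc
  obtain ⟨B, D, rfl, hB⟩ := List.eq_append_cons_of_mem
    (List.count_pos_iff.1 (by omega : 0 < X.count a))
  have hp' := (((perm_insert a A B D).symm.trans hp).cons_inv).cons_inv
  have hlt : ∀ x ∈ A ++ (B ++ D), a < x := by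
    intro x hx
    have := hp'.mem_iff.1 hx
    simp only [List.mem_flatMap, List.mem_range'_1] at this
    obtain ⟨i, hi, h⟩ := this
    simp at h; omega
  rw [triplewise_insert (fun x hx => hlt x (by simp [hx])) (fun x hx => hlt x (by simp [hx]))
    (fun x hx => hlt x (by simp [hx]))] at ht
  exact ⟨A, B, D, rfl, mem_words.2 ⟨hp', ht.1⟩, ht.2⟩

theorem append_cons_inj {α : Type*} {a : α} {A A' X X' : List α} (hA : a ∉ A) (hA' : a ∉ A')
    (h : A ++ a :: X = A' ++ a :: X') : A = A' ∧ X = X' := by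
  induction A generalizing A' with
  | nil => cases A' <;> grind
  | cons b A ih => cases A' <;> grind

/-- Insertion is a bijection: the two occurrences of the minimum `a` in `w` recover `A`, `B` and
`D`. -/
theorem sum_words_succ {M : Type*} [AddCommMonoid M] (a m : ℕ) (F : List ℕ → M) :
    ∑ w ∈ words a (m + 1), F w = ∑ σ ∈ words (a + 1) m, ∑ l₁ ∈ freeSlots σ,
      ∑ l₂ ∈ (freeSlots σ).filter (· ≤ l₁), F (insertPair a σ l₁ l₂) := by
  simp only [Finset.sum_sigma']
  symm
  refine Finset.sum_bij (fun s _ => insertPair a s.1 s.2.1 s.2.2) ?_ ?_ ?_ (fun _ _ => rfl)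
  · rintro ⟨σ, l₁, l₂⟩ h
    simp only [Finset.mem_sigma, Finset.mem_filter] at h
    obtain ⟨A, B, D, rfl, rfl, rfl, hs, hd₁, hd₂⟩ := exists_split h.2.1 h.2.2.1 h.2.2.2
    simp only [insertPair_append]
    exact insert_mem_words h.1 hs hd₁ hd₂
  · rintro ⟨σ, l₁, l₂⟩ h ⟨σ', l₁', l₂'⟩ h' heq
    simp only [Finset.mem_sigma, Finset.mem_filter] at h h'
    obtain ⟨A, B, D, rfl, rfl, rfl, -⟩ := exists_split h.2.1 h.2.2.1 h.2.2.2
    obtain ⟨A', B', D', rfl, rfl, rfl, -⟩ := exists_split h'.2.1 h'.2.2.1 h'.2.2.2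
    simp only [insertPair_append] at heq
    have hlt : ∀ x ∈ A ++ (B ++ D), a < x := fun x hx => le_of_mem_words h.1 hx
    have hlt' : ∀ x ∈ A' ++ (B' ++ D'), a < x := fun x hx => le_of_mem_words h'.1 hx
    have hA : a ∉ A := fun hx => lt_irrefl a (hlt a (by simp [hx]))
    have hA' : a ∉ A' := fun hx => lt_irrefl a (hlt' a (by simp [hx]))
    have hB : a ∉ B := fun hx => lt_irrefl a (hlt a (by simp [hx]))
    have hB' : a ∉ B' := fun hx => lt_irrefl a (hlt' a (by simp [hx]))
    obtain ⟨rfl, htail⟩ := append_cons_inj hA hA' heq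
    obtain ⟨rfl, rfl⟩ := append_cons_inj hB hB' htail
    rfl
  · intro w hw
    obtain ⟨A, B, D, rfl, hσ, hs, hd₁, hd₂⟩ := exists_eq_insert_of_mem_words hw
    refine ⟨⟨A ++ (B ++ D), B.length + D.length, D.length⟩, ?_, insertPair_append a A B D⟩
    simp only [Finset.mem_sigma, Finset.mem_filter, mem_freeSlots]
    refine ⟨hσ, ?_, ?_, Nat.le_add_left _ _⟩
    · rw [← List.length_append]
      exact isFreeSlot_append.2 ⟨hd₁, hs⟩
    · rw [← List.append_assoc]
      exact isFreeSlot_append.2 ⟨hd₂, (List.pairwise_append.1 hs).2.1⟩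

end Insertion

/-! ### How insertion changes the label of a word. -/

section Labels

theorem isFreeSlot_insert_of_le {a l : ℕ} {A B D : List ℕ} (hD : ∀ x ∈ D, a < x)
    (hl : l ≤ D.length) :
    IsFreeSlot (A ++ a :: (B ++ a :: D)) l ↔ IsFreeSlot (A ++ (B ++ D)) l := by
  obtain ⟨D, E, rfl, rfl⟩ : ∃ D₁ E, D = D₁ ++ E ∧ E.length = l :=
    ⟨D.take (D.length - l), D.drop (D.length - l), by simp, by simp; omega⟩
  have ha : a ∉ E := fun h => lt_irrefl a (hD a (by simp [h]))
  rw [show A ++ a :: (B ++ a :: (D ++ E)) = (A ++ a :: (B ++ a :: D)) ++ E by simp,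
    show A ++ (B ++ (D ++ E)) = (A ++ (B ++ D)) ++ E by simp, isFreeSlot_append, isFreeSlot_append]
  simp [List.disjoint_append_left, List.disjoint_cons_left, ha]

/-- A suffix longer than `D` contains the second `a`, hence by disjointness the first one too; then
`a` precedes a larger letter of `B ++ D`, so the suffix is not decreasing. -/
theorem not_isFreeSlot_insert {a l : ℕ} {A B D : List ℕ} (hB : ∀ x ∈ B, a < x)
    (hD : ∀ x ∈ D, a < x) (hne : B ++ D ≠ []) (hl : D.length < l) :
    ¬ IsFreeSlot (A ++ a :: (B ++ a :: D)) l := by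
  rintro ⟨A', E, h, rfl, hd, hs⟩
  obtain ⟨C, rfl⟩ : a :: D <:+ E := List.suffix_of_suffix_length_le
    (l₃ := A ++ a :: (B ++ a :: D)) ⟨A ++ a :: B, by simp⟩ ⟨A', h.symm⟩ (by simp; omega)
  have haA : a ∉ A' := fun h => hd h (by simp)
  rw [show A ++ a :: (B ++ a :: D) = (A ++ a :: B) ++ a :: D by simp, ← List.append_assoc,
    List.append_cancel_right_eq] at h
  obtain ⟨C', rfl⟩ : ∃ C', C = C' ++ a :: B := by
    rcases List.append_eq_append_iff.1 h with ⟨C', rfl, h'⟩ | ⟨C', rfl, rfl⟩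
    · cases C' with
      | nil => exact ⟨[], by simpa using h'.symm⟩
      | cons b C' =>
        rw [List.cons_append, List.cons.injEq] at h'
        exact absurd (by simp [h'.1]) haA
    · exact ⟨C', rfl⟩
  have hs' : (a :: (B ++ D)).Pairwise (· ≥ ·) := by
    refine hs.sublist ?_
    rw [List.append_assoc, List.cons_append]
    exact (((List.sublist_cons_self a D).append_left B).cons_cons a).trans
      (List.sublist_append_right _ _)
  obtain ⟨b, hb⟩ := List.exists_mem_of_ne_nil _ hne
  have h₁ := (List.pairwise_cons.1 hs').1 b hb
  have h₂ : a < b := by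
    rcases List.mem_append.1 hb with h | h
    · exact hB b h
    · exact hD b h
  omega

theorem freeSlots_insert {a : ℕ} {A B D : List ℕ} (hB : ∀ x ∈ B, a < x)
    (hD : ∀ x ∈ D, a < x) (hne : B ++ D ≠ []) :
    freeSlots (A ++ a :: (B ++ a :: D)) =
      (freeSlots (A ++ (B ++ D))).filter (· ≤ D.length) := by
  ext l
  rw [Finset.mem_filter, mem_freeSlots, mem_freeSlots]
  rcases le_or_gt l D.length with hl | hl
  · simp [isFreeSlot_insert_of_le hD hl, hl]
  · simp [not_isFreeSlot_insert hB hD hne hl, hl]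

/-- The leftmost surviving free slot is right after the second `a`, which is an ascent unless the
word ends there. -/
theorem ascFlag_insert {a : ℕ} {A B D : List ℕ} (hB : ∀ x ∈ B, a < x)
    (hD : ∀ x ∈ D, a < x) (hne : B ++ D ≠ []) (hfree : D.length ∈ freeSlots (A ++ (B ++ D))) :
    ascFlag (A ++ a :: (B ++ a :: D)) = decide (D.length ≠ 0) := by
  rw [ascFlag, decide_eq_decide, freeSlots_insert hB hD hne]
  constructor
  · rintro ⟨l, hl, A', u, v, E, -, h, -⟩ h0
    rw [Finset.mem_filter] at hl
    omega
  · intro h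
    refine ⟨D.length, Finset.mem_filter.2 ⟨hfree, le_rfl⟩, ?_⟩
    cases D with
    | nil => simp at h
    | cons v D => exact ⟨A ++ a :: B, a, v, D, by simp, rfl, hD v (by simp)⟩

theorem isFreeSlot_append_pair {a l : ℕ} {A : List ℕ} (hA : ∀ x ∈ A, a < x) :
    IsFreeSlot (A ++ [a, a]) (l + 2) ↔ IsFreeSlot A l := by
  constructor
  · rintro ⟨A', E, h, hl, hd, hs⟩
    obtain ⟨E, rfl⟩ : [a, a] <:+ E := List.suffix_of_suffix_length_le
      (l₃ := A ++ [a, a]) ⟨A, rfl⟩ ⟨A', h.symm⟩ (by simp; omega)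
    rw [← List.append_assoc, List.append_cancel_right_eq] at h
    simp only [List.length_append, List.length_cons, List.length_nil] at hl
    exact ⟨A', E, h, by omega, (List.disjoint_append_right.1 hd).1, (List.pairwise_append.1 hs).1⟩
  · rintro ⟨A', E, rfl, rfl, hd, hs⟩
    refine ⟨A', E ++ [a, a], by simp, by simp, ?_, ?_⟩
    · rw [List.disjoint_append_right]
      refine ⟨hd, fun x hx hx' => ?_⟩
      have := hA x (by simp [hx])
      simp at hx'
      omega
    · rw [List.pairwise_append]
      refine ⟨hs, by simp, fun x hx y hy => ?_⟩
      have := hA x (by simp [hx])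
      simp at hy
      omega

theorem freeSlots_append_pair {a : ℕ} {A : List ℕ} (hA : ∀ x ∈ A, a < x) :
    freeSlots (A ++ [a, a]) = insert 0 ((freeSlots A).map (addRightEmbedding 2)) := by
  ext l
  simp only [Finset.mem_insert, Finset.mem_map, addRightEmbedding_apply, mem_freeSlots]
  match l with
  | 0 => simpa using mem_freeSlots.1 (zero_mem_freeSlots _)
  | 1 =>
    -- The slot between the two copies of `a` separates equal letters.
    refine iff_of_false ?_ (by simp)
    rw [show A ++ [a, a] = (A ++ [a]) ++ [a] by simp, show 1 = [a].length from rfl,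
      isFreeSlot_append]
    simp
  | l + 2 => simp [isFreeSlot_append_pair hA]

theorem isAscSlot_append_pair {a l : ℕ} {A : List ℕ} (hA : ∀ x ∈ A, a < x) :
    IsAscSlot (A ++ [a, a]) (l + 2) ↔ IsAscSlot A l := by
  constructor
  · rintro ⟨A', u, v, E, h, hl, huv⟩
    obtain ⟨F, hF⟩ : [a, a] <:+ v :: E := List.suffix_of_suffix_length_le
      (l₃ := A ++ [a, a]) ⟨A, rfl⟩ ⟨A' ++ [u], by simp [h]⟩ (by simp; omega)
    rw [← hF, show A' ++ u :: (F ++ [a, a]) = (A' ++ u :: F) ++ [a, a] by simp,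
      List.append_cancel_right_eq] at h
    cases F with
    | nil =>
      simp only [List.nil_append, List.cons.injEq] at hF
      have := hA u (by simp [h])
      omega
    | cons w F =>
      simp only [List.cons_append, List.cons.injEq] at hF
      have hlen := congrArg List.length hF.2
      simp at hlen
      exact ⟨A', u, v, F, by rw [h, hF.1], by omega, huv⟩
  · rintro ⟨A', u, v, E, rfl, rfl, huv⟩
    exact ⟨A', u, v, E ++ [a, a], by simp, by simp, huv⟩

theorem ascFlag_append_pair {a : ℕ} {A : List ℕ} (hA : ∀ x ∈ A, a < x) :
    ascFlag (A ++ [a, a]) = ascFlag A := by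
  rw [ascFlag, ascFlag, decide_eq_decide, freeSlots_append_pair hA]
  constructor
  · rintro ⟨l, hl, h⟩
    simp only [Finset.mem_insert, Finset.mem_map, addRightEmbedding_apply] at hl
    rcases hl with rfl | ⟨l, hl, rfl⟩
    · obtain ⟨_, _, _, _, -, h, -⟩ := h; omega
    · exact ⟨l, hl, (isAscSlot_append_pair hA).1 h⟩
  · rintro ⟨l, hl, h⟩
    exact ⟨l + 2, by simp [hl], (isAscSlot_append_pair hA).2 h⟩

/-- A free slot further left would have the ascent inside its decreasing suffix. Hence only the
leftmost free slot can lie on an ascent, and one Boolean suffices in the label. -/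
theorem le_of_isAscSlot {σ : List ℕ} {l l' : ℕ} (h : IsAscSlot σ l) (h' : IsFreeSlot σ l') :
    l' ≤ l := by
  obtain ⟨A, u, v, E, rfl, rfl, huv⟩ := h
  obtain ⟨A', E', h, rfl, -, hs⟩ := h'
  by_contra hl
  have hsuf : u :: v :: E <:+ E' := List.suffix_of_suffix_length_le
      (l₃ := A ++ u :: v :: E) ⟨A, rfl⟩ ⟨A', h.symm⟩ (by simp; omega)
  have := (List.pairwise_cons.1 (hs.sublist hsuf.sublist)).1 v (by simp)
  omega

theorem slotRank_eq_zero_iff {σ : List ℕ} {l : ℕ} : slotRank σ l = 0 ↔ l = 0 := by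
  rw [slotRank, Finset.card_eq_zero]
  constructor
  · intro h
    by_contra hl
    have : 0 ∈ (freeSlots σ).filter (· < l) :=
      Finset.mem_filter.2 ⟨zero_mem_freeSlots σ, Nat.pos_of_ne_zero hl⟩
    simp [h] at this
  · rintro rfl; simp

theorem slotRank_lt {σ : List ℕ} {l l' : ℕ} (h : l ∈ freeSlots σ) (hl : l < l') :
    slotRank σ l < slotRank σ l' := by
  refine Finset.card_lt_card (Finset.ssubset_iff_subset_ne.2 ⟨?_, ?_⟩)
  · exact fun x hx => by
      rw [Finset.mem_filter] at hx ⊢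
      exact ⟨hx.1, hx.2.trans hl⟩
  · intro heq
    have : l ∈ (freeSlots σ).filter (· < l') := Finset.mem_filter.2 ⟨h, hl⟩
    rw [← heq] at this
    simp at this

theorem slotRank_of_isAscSlot {σ : List ℕ} {l : ℕ} (h : IsAscSlot σ l) (hl : l ∈ freeSlots σ) :
    slotRank σ l + 1 = (freeSlots σ).card := by
  rw [slotRank, ← card_filter_le_eq hl, Finset.filter_true_of_mem]
  exact fun x hx => le_of_isAscSlot h (mem_freeSlots.1 hx)

theorem ascFlag_and_slotRank_iff {σ : List ℕ} {l : ℕ} (hl : l ∈ freeSlots σ) :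
    (ascFlag σ = true ∧ slotRank σ l + 1 = (freeSlots σ).card) ↔ IsAscSlot σ l := by
  constructor
  · rintro ⟨h, h'⟩
    simp only [ascFlag, decide_eq_true_eq] at h
    obtain ⟨l₀, h₀, hasc⟩ := h
    rcases (le_of_isAscSlot hasc (mem_freeSlots.1 hl)).lt_or_eq with h | rfl
    · have h₁ := slotRank_lt hl h
      have h₂ := slotRank_of_isAscSlot hasc h₀
      omega
    · exact hasc
  · intro h
    refine ⟨?_, slotRank_of_isAscSlot h hl⟩
    simp only [ascFlag, decide_eq_true_eq]
    exact ⟨l, hl, h⟩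

end Labels

/-! ### Weights along the tree and the generating function. -/

section Weights

variable {R : Type*} [CommRing R]

/-- The product over the adjacent pairs of a word of `p` for a plateau, `q` for a descent and `r`
for an ascent. -/
def pathWeight (p q r : R) : List ℕ → R
  | [] => 1
  | [_] => 1
  | x :: y :: l => (if x = y then p else if y < x then q else r) * pathWeight p q r (y :: l)

theorem pathWeight_append (p q r : R) (A X : List ℕ) (v : ℕ) :
    pathWeight p q r (A ++ v :: X) =
      pathWeight p q r (A ++ [v]) * pathWeight p q r (v :: X) := by
  induction A with
  | nil => simp [pathWeight]
  | cons x A ih =>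
    cases A with
    | nil => simp [pathWeight]
    | cons y A =>
      simp only [List.cons_append] at ih ⊢
      rw [pathWeight, ih, pathWeight, mul_assoc]

theorem pathWeight_append_zero (p q r : R) {σ : List ℕ} (hσ : ∀ x ∈ σ, 0 < x) (hne : σ ≠ []) :
    pathWeight p q r (σ ++ [0]) = q * (p ^ plat σ * q ^ des σ * r ^ asc σ) := by
  induction σ with
  | nil => simp at hne
  | cons x σ ih =>
    cases σ with
    | nil =>
      have hx : 0 < x := hσ x (by simp)
      simp [pathWeight, plat, des, asc, hx, hx.ne']
    | cons y σ =>
      have ih := ih (fun z hz => hσ z (List.mem_cons_of_mem _ hz)) (by simp)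
      simp only [List.cons_append] at ih ⊢
      rw [pathWeight, ih]
      simp only [plat, des, asc, List.tail_cons, List.zip_cons_cons, List.countP_cons]
      rcases lt_trichotomy x y with h | h | h
      · simp [h, h.ne, h.le.not_gt]; ring
      · simp [h]; ring
      · simp [h, h.ne', h.le.not_gt]; ring

open Classical in
/-- The effect on the weight of inserting a small letter `a` in front of the suffix `E`. -/
theorem pathWeight_insert (p q r : R) {a : ℕ} {A E : List ℕ} (B B' : List ℕ) (ha : 0 < a)
    (hA : ∀ x ∈ A, a < x) (hE : ∀ x ∈ E, a < x) (hd : A.Disjoint E)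
    (hne : A ≠ [] ∨ B = [] ∧ B' = []) :
    pathWeight p q r (B ++ A ++ a :: (E ++ [0])) =
      (if E.length = 0 ∨ IsAscSlot (B' ++ A ++ E) E.length then q else r) *
        pathWeight p q r (B ++ A ++ (E ++ [0])) := by
  rcases List.eq_nil_or_concat' A with rfl | ⟨A, u, rfl⟩
  · obtain ⟨rfl, rfl⟩ : B = [] ∧ B' = [] := by simpa using hne
    cases E with
    | nil => simp [pathWeight, ha, ha.ne']
    | cons v E =>
      have hv := hE v (by simp)
      have : ¬ IsAscSlot (v :: E) (E.length + 1) := by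
        rintro ⟨A', u', v', E', h, hl, -⟩
        have := congrArg List.length h
        simp at this; omega
      simp [pathWeight, this, hv.ne, hv.le.not_gt]
  · have hu : a < u := hA u (by simp)
    cases E with
    | nil =>
      rw [show B ++ (A ++ [u]) ++ a :: ([] ++ [0]) = (B ++ A) ++ u :: [a, 0] by simp,
        show B ++ (A ++ [u]) ++ ([] ++ [0]) = (B ++ A) ++ u :: [0] by simp,
        pathWeight_append, pathWeight_append (X := [0])]
      simp [pathWeight, ha, ha.ne', hu, hu.ne', (ha.trans hu), (ha.trans hu).ne']
      ring
    | cons v E =>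
      have hv : a < v := hE v (by simp)
      -- Disjointness rules out a plateau at the slot, so only an ascent or a descent is broken.
      have huv : u ≠ v := fun h => hd (a := u) (by simp) (by simp [h])
      rw [show B ++ (A ++ [u]) ++ a :: (v :: E ++ [0]) =
          (B ++ A) ++ u :: a :: v :: (E ++ [0]) by simp,
        show B ++ (A ++ [u]) ++ (v :: E ++ [0]) = (B ++ A) ++ u :: v :: (E ++ [0]) by simp,
        show B' ++ (A ++ [u]) ++ v :: E = (B' ++ A) ++ u :: v :: E by simp, List.length_cons,
        isAscSlot_append, pathWeight_append, pathWeight_append (X := v :: (E ++ [0]))]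
      simp only [pathWeight, hu, hu.ne', hv.ne, hv.le.not_gt, huv, if_true, if_false,
        Nat.succ_ne_zero, false_or]
      rcases huv.lt_or_gt with h | h
      · simp only [h, h.le.not_gt, if_true, if_false]; ring
      · simp only [h, h.le.not_gt, if_true, if_false]; ring

theorem pathWeight_double (p q r : R) (a : ℕ) (A X : List ℕ) :
    pathWeight p q r (A ++ a :: a :: X) = p * pathWeight p q r (A ++ a :: X) := by
  rw [pathWeight_append, pathWeight_append (X := X)]
  simp only [pathWeight, if_true]
  ring

open Classical in
theorem slotWeight_slotRank {T : Type*} (q r : T) {σ : List ℕ} {l : ℕ} (hl : l ∈ freeSlots σ) :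
    slotWeight q r (ascFlag σ) (freeSlots σ).card (slotRank σ l) =
      if l = 0 ∨ IsAscSlot σ l then q else r := by
  rw [slotWeight]
  refine if_congr ?_ rfl rfl
  rw [slotRank_eq_zero_iff, ascFlag_and_slotRank_iff hl]

/-- The effect on the weight of inserting two copies of a small letter `a`. -/
theorem pathWeight_insert_pair (p q r : R) {a : ℕ} {A B D : List ℕ} (ha : 0 < a)
    (hlt : ∀ x ∈ A ++ (B ++ D), a < x) (hs : (B ++ D).Pairwise (· ≥ ·))
    (h₁ : A.Disjoint (B ++ D)) (h₂ : (A ++ B).Disjoint D) :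
    pathWeight p q r (A ++ a :: (B ++ a :: D) ++ [0]) =
      pairWeight p q r (ascFlag (A ++ (B ++ D))) (freeSlots (A ++ (B ++ D))).card
        (slotRank (A ++ (B ++ D)) D.length) (slotRank (A ++ (B ++ D)) (B.length + D.length)) *
      pathWeight p q r (A ++ (B ++ D) ++ [0]) := by
  classical
  have hA : ∀ x ∈ A, a < x := fun x hx => hlt x (by simp [hx])
  have hB : ∀ x ∈ B, a < x := fun x hx => hlt x (by simp [hx])
  have hD : ∀ x ∈ D, a < x := fun x hx => hlt x (by simp [hx])
  have hf₁ : B.length + D.length ∈ freeSlots (A ++ (B ++ D)) := by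
    rw [mem_freeSlots, ← List.length_append]
    exact isFreeSlot_append.2 ⟨h₁, hs⟩
  have hf₂ : D.length ∈ freeSlots (A ++ (B ++ D)) := by
    rw [mem_freeSlots, ← List.append_assoc]
    exact isFreeSlot_append.2 ⟨h₂, (List.pairwise_append.1 hs).2.1⟩
  have hBD : ∀ x ∈ B ++ D, a < x := fun x hx => hlt x (List.mem_append_right A hx)
  have hfirst := pathWeight_insert p q r [] [] ha hA hBD h₁ (Or.inr ⟨rfl, rfl⟩)
  simp only [List.nil_append, List.length_append] at hfirst
  rw [pairWeight, slotWeight_slotRank q r hf₁, slotWeight_slotRank q r hf₂]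
  cases B with
  | nil =>
    simp only [List.nil_append, List.length_nil, zero_add, if_true] at hfirst ⊢
    rw [List.append_assoc, List.cons_append, List.cons_append, pathWeight_double, hfirst,
      List.append_assoc, mul_assoc]
  | cons b B =>
    rw [if_neg (slotRank_lt hf₂ (by simp)).ne]
    -- The right copy is inserted after the left one is in place. Its gain depends only on its
    -- neighbours, and `b :: B` shields it from the left copy, so the original word still decides
    -- whether it sits on an ascent.
    have hsecond := pathWeight_insert p q r (A ++ [a]) A ha hB hD
      (fun x hx hx' => h₂ (by simp at hx ⊢; tauto) hx') (Or.inl (by simp))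
    rw [List.append_assoc A (b :: B) D] at hsecond
    rw [show A ++ a :: (b :: B ++ a :: D) ++ [0] = A ++ [a] ++ b :: B ++ a :: (D ++ [0]) by simp,
      hsecond, show A ++ [a] ++ b :: B ++ (D ++ [0]) = A ++ a :: (b :: B ++ D ++ [0]) by simp,
      hfirst, mul_assoc, List.append_assoc A]

/-- Each word is a node at depth `m` of the tree, so the sum counts depth `m + n`. The induction
trades a level of words for a level of tree; `0 < a` keeps the final 0 below all letters. -/
theorem sum_words_mul_treeWeight (p q r : R) (m : ℕ) : ∀ a n, 0 < a →
    ∑ σ ∈ words a m, pathWeight p q r (σ ++ [0]) *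
      treeWeight p q r n (ascFlag σ) (freeSlots σ).card = treeWeight p q r (m + n) false 1 := by
  induction m with
  | zero =>
    intro a n ha
    have h₁ : freeSlots [] = {0} := by
      ext l
      rw [mem_freeSlots, Finset.mem_singleton]
      constructor
      · rintro ⟨A, E, h, rfl, -⟩
        simp [(List.append_eq_nil_iff.1 h.symm).2]
      · rintro rfl; exact ⟨[], [], by simp⟩
    have h₂ : ascFlag [] = false := by
      simp only [ascFlag, decide_eq_false_iff_not]
      rintro ⟨l, -, A, u, v, E, h, -⟩
      simp at h
    simp [words_zero, h₁, h₂, pathWeight]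
  | succ m ih =>
    intro a n ha
    rw [show m + 1 + n = m + (n + 1) by omega, ← ih (a + 1) (n + 1) (Nat.succ_pos a),
      sum_words_succ]
    refine Finset.sum_congr rfl fun σ hσ => ?_
    rw [treeWeight, ← sum_pairs_eq_sum_range (freeSlots σ) fun i j =>
      pairWeight p q r (ascFlag σ) (freeSlots σ).card i j *
        treeWeight p q r n (childFlag (ascFlag σ) i j) (childSlots (freeSlots σ).card i j),
      Finset.mul_sum]
    refine Finset.sum_congr rfl fun l₁ h₁ => ?_
    rw [Finset.mul_sum]
    refine Finset.sum_congr rfl fun l₂ h₂ => ?_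
    rw [Finset.mem_filter] at h₂
    have hlt : ∀ x ∈ σ, a < x := fun x hx => le_of_mem_words hσ hx
    obtain ⟨A, B, D, rfl, rfl, rfl, hs, hd₁, hd₂⟩ := exists_split h₁ h₂.1 h₂.2
    have hA : ∀ x ∈ A, a < x := fun x hx => hlt x (by simp [hx])
    have hB : ∀ x ∈ B, a < x := fun x hx => hlt x (by simp [hx])
    have hD : ∀ x ∈ D, a < x := fun x hx => hlt x (by simp [hx])
    rw [insertPair_append, pathWeight_insert_pair p q r ha hlt hs hd₁ hd₂]
    change _ = _ * (pairWeight p q r _ _ (slotRank (A ++ (B ++ D)) D.length)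
      (slotRank (A ++ (B ++ D)) (B.length + D.length)) * treeWeight p q r n
        (childFlag _ (slotRank (A ++ (B ++ D)) D.length)
          (slotRank (A ++ (B ++ D)) (B.length + D.length)))
        (childSlots _ (slotRank (A ++ (B ++ D)) D.length)
          (slotRank (A ++ (B ++ D)) (B.length + D.length))))
    have hlabel : ascFlag (A ++ a :: (B ++ a :: D)) =
          childFlag (ascFlag (A ++ (B ++ D))) (slotRank (A ++ (B ++ D)) D.length)
            (slotRank (A ++ (B ++ D)) (B.length + D.length)) ∧
        (freeSlots (A ++ a :: (B ++ a :: D))).card =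
          childSlots (freeSlots (A ++ (B ++ D))).card (slotRank (A ++ (B ++ D)) D.length)
            (slotRank (A ++ (B ++ D)) (B.length + D.length)) := by
      rw [childFlag, childSlots]
      -- Both copies at the right end keep every old slot, shifted by two, and add one; otherwise
      -- only the slots up to the right copy survive.
      by_cases hne : B ++ D = []
      · obtain ⟨rfl, rfl⟩ := List.append_eq_nil_iff.1 hne
        have h0 : slotRank (A ++ ([] ++ [])) (([] : List ℕ).length + ([] : List ℕ).length) = 0 :=
          slotRank_eq_zero_iff.2 rfl
        rw [if_pos h0, if_pos h0]
        simp only [List.nil_append, List.append_nil]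
        refine ⟨ascFlag_append_pair hA, ?_⟩
        rw [freeSlots_append_pair hA, Finset.card_insert_of_notMem (by simp), Finset.card_map]
      · have h0 : slotRank (A ++ (B ++ D)) (B.length + D.length) ≠ 0 := by
          rw [Ne, slotRank_eq_zero_iff, ← List.length_append, List.length_eq_zero_iff]
          exact hne
        rw [if_neg h0, if_neg h0, ascFlag_insert hB hD hne h₂.1, freeSlots_insert hB hD hne,
          card_filter_le_eq h₂.1]
        refine ⟨?_, rfl⟩
        rw [decide_eq_decide, Ne, Ne, slotRank_eq_zero_iff]
    rw [hlabel.1, hlabel.2]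
    ring

/-- The final 0 adds one descent to each nonempty word but none to the empty one; `-q + 1` corrects
the constant term. -/
theorem mul_genFun_eq (p q r : R) :
    PowerSeries.C q * genFun [1, 2, 3] p q r - PowerSeries.C q + 1 =
      PowerSeries.mk fun n => treeWeight p q r n false 1 := by
  ext n
  rw [PowerSeries.coeff_mk, map_add, map_sub, PowerSeries.coeff_C_mul, genFun,
    PowerSeries.coeff_mk, C, avoiders_eq_words]
  cases n with
  | zero => simp [words_zero, plat, des, asc, treeWeight]
  | succ n =>
    have h := sum_words_mul_treeWeight p q r (n + 1) 1 0 one_pos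
    simp only [treeWeight, mul_one] at h
    rw [treeWeight, ← h, Finset.mul_sum, PowerSeries.coeff_C, if_neg (Nat.succ_ne_zero n),
      PowerSeries.coeff_one, if_neg (Nat.succ_ne_zero n), sub_zero, add_zero]
    refine Finset.sum_congr rfl fun σ hσ => ?_
    refine (pathWeight_append_zero p q r (fun x hx => le_of_mem_words hσ hx) ?_).symm
    rintro rfl
    have := (mem_words.1 hσ).1
    rw [doubled_succ] at this
    exact absurd this.symm (List.not_perm_cons_nil)

end Weights

end StirlingPerm

/-- Here `p, q, r` are arbitrary elements of an arbitrary commutative ring `R`; for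
`R = ℤ[p, q, r]` they may be taken to be the indeterminates. -/
theorem theorem6 {R : Type*} [CommRing R] (p q r : R) (x P Q S f : PowerSeries R)
    (hx : x = PowerSeries.X) (hP : P = PowerSeries.C p) (hQ : Q = PowerSeries.C q)
    (hS : S = PowerSeries.C r)
    (hf : f = Q * StirlingPerm.genFun [1, 2, 3] p q r - Q + 1) :
    f = 1 + P * Q * x * (-1 + (2 + x * (P * S + Q * S - P * Q)) * f
      - P * Q * x * (1 - x * (P - S) * (Q - S)) * f ^ 2) * f := by
  refine StirlingPerm.treeWeight_cubic p q r x P Q S f hx hP hQ hS ?_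
  rw [hf, hQ, StirlingPerm.mul_genFun_eq]
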